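/- Let $k\ge 1$ be an integer. Let $\mathbb{H}^k=\mathbb{R}^{2k}\times\mathbb{R}$ be the Heisenberg group with group law $(v,t)\cdot(v',t')=(v+v',\,t+t'+\omega(v,v')/2)$, where $\omega(v,v')=\sum_{j=1}^k (v_jv'_{j+k}-v_{j+k}v'_j)$, equipped with the Korányi norm $\|(v,t)\|=(|v|^4+16t^2)^{1/4}$ ($|\cdot|$ being the Euclidean norm on $\mathbb{R}^{2k}$) and the Korányi distance $d(p,q)=\|q^{-1}\cdot p\|$. Let $B(p,r)$ denote the open balls and $\mathcal{H}^s$ the $s$-dimensional Hausdorff measure of $(\mathbb{H}^k,d)$. For a Euclidean unit vector $\nu\in\mathbb{S}^{2k-1}\subset\mathbb{R}^{2k}$ set $\mathbb{V}_\nu=(\mathbb{R}\nu)^\perp\times\mathbb{R}$ and $\mathbb{L}_\nu=\mathbb{R}\nu\times\{0\}$. Every $p\in\mathbb{H}^k$ is uniquely of the form $p=\pi_{\mathbb{V}_\nu}(p)\cdot\pi_{\mathbb{L}_\nu}(p)$ with $\pi_{\mathbb{V}_\nu}(p)\in\mathbb{V}_\nu$ and $\pi_{\mathbb{L}_\nu}(p)\in\mathbb{L}_\nu$.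 For $\lambda\in(0,1)$ let $C_\lambda(\nu)=\{p\in\mathbb{H}^k:\lambda\|p\|<\|\pi_{\mathbb{L}_\nu}(p)\|\}$. A set $\Gamma\subset\mathbb{H}^k$ is an intrinsic $\lambda$-Lipschitz graph if there is $\nu\in\mathbb{S}^{2k-1}$ such that $\pi_{\mathbb{V}_\nu}(\Gamma)=\mathbb{V}_\nu$ and $(p\cdot C_\lambda(\nu))\cap\Gamma=\emptyset$ for all $p\in\Gamma$. Then for every $\lambda\in(0,1)$ there is a constant $C\ge 1$ (depending only on $k$ and $\lambda$, and in particular not on the direction $\nu$) such that every intrinsic $\lambda$-Lipschitz graph $\Gamma\subset\mathbb{H}^k$ is $C$-Ahlfors regular of dimension $2k+1$, that is, $\Gamma$ is closed and $$C^{-1}r^{2k+1}\le\mathcal{H}^{2k+1}(\Gamma\cap B(p,r))\le C\,r^{2k+1}\quad\text{for all }p\in\Gamma,\ r>0.$$ -/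

import Mathlib

open MeasureTheory Measure

/-- The underlying set `ℝ^{2k} × ℝ` of the Heisenberg group. The coordinates of `ℝ^{2k}` are
indexed by `Fin k ⊕ Fin k`: `inl j` stands for the index `j` and `inr j` for the index `j + k`. -/
@[ext]
structure Heisenberg (k : ℕ) where
  /-- The horizontal component, in `ℝ^{2k}` with its Euclidean norm. -/
  v : EuclideanSpace ℝ (Fin k ⊕ Fin k)
  /-- The vertical component. -/
  t : ℝ

namespace Heisenberg

noncomputable section

variable {k : ℕ}

/-- The standard symplectic form on `ℝ^{2k}`. -/
def omega (v w : EuclideanSpace ℝ (Fin k ⊕ Fin k)) : ℝ :=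
  ∑ j : Fin k, (v (Sum.inl j) * w (Sum.inr j) - v (Sum.inr j) * w (Sum.inl j))

lemma omega_add_left (u v w : EuclideanSpace ℝ (Fin k ⊕ Fin k)) :
    omega (u + v) w = omega u w + omega v w := by
  simp only [omega, ← Finset.sum_add_distrib, PiLp.add_apply]
  exact Finset.sum_congr rfl fun _ _ => by ring

lemma omega_swap (v w : EuclideanSpace ℝ (Fin k ⊕ Fin k)) : omega w v = -omega v w := by
  simp only [omega, ← Finset.sum_neg_distrib]
  exact Finset.sum_congr rfl fun _ _ => by ring

lemma omega_add_right (u v w : EuclideanSpace ℝ (Fin k ⊕ Fin k)) :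
    omega u (v + w) = omega u v + omega u w := by
  rw [omega_swap, omega_add_left, omega_swap u v, omega_swap u w]; ring

lemma omega_smul_left (s : ℝ) (v w : EuclideanSpace ℝ (Fin k ⊕ Fin k)) :
    omega (s • v) w = s * omega v w := by
  simp only [omega, Finset.mul_sum, PiLp.smul_apply, smul_eq_mul]
  exact Finset.sum_congr rfl fun _ _ => by ring

lemma omega_smul_right (s : ℝ) (v w : EuclideanSpace ℝ (Fin k ⊕ Fin k)) :
    omega v (s • w) = s * omega v w := by
  rw [omega_swap, omega_smul_left, omega_swap v w]; ring

lemma omega_self (v : EuclideanSpace ℝ (Fin k ⊕ Fin k)) : omega v v = 0 := by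
  linarith [omega_swap v v]

lemma omega_neg_left (v w : EuclideanSpace ℝ (Fin k ⊕ Fin k)) :
    omega (-v) w = -omega v w := by
  rw [← neg_one_smul ℝ v, omega_smul_left]; ring

lemma omega_neg_right (v w : EuclideanSpace ℝ (Fin k ⊕ Fin k)) :
    omega v (-w) = -omega v w := by
  rw [← neg_one_smul ℝ w, omega_smul_right]; ring

lemma omega_zero_left (w : EuclideanSpace ℝ (Fin k ⊕ Fin k)) : omega 0 w = 0 := by
  simp [omega]

lemma omega_zero_right (w : EuclideanSpace ℝ (Fin k ⊕ Fin k)) : omega w 0 = 0 := by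
  simp [omega]

instance : Mul (Heisenberg k) := ⟨fun p q => ⟨p.v + q.v, p.t + q.t + omega p.v q.v / 2⟩⟩

instance : One (Heisenberg k) := ⟨⟨0, 0⟩⟩

instance : Inv (Heisenberg k) := ⟨fun p => ⟨-p.v, -p.t⟩⟩

@[simp] lemma mul_v (p q : Heisenberg k) : (p * q).v = p.v + q.v := rfl
@[simp] lemma mul_t (p q : Heisenberg k) : (p * q).t = p.t + q.t + omega p.v q.v / 2 := rfl
@[simp] lemma one_v : (1 : Heisenberg k).v = 0 := rfl
@[simp] lemma one_t : (1 : Heisenberg k).t = 0 := rfl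
@[simp] lemma inv_v (p : Heisenberg k) : p⁻¹.v = -p.v := rfl
@[simp] lemma inv_t (p : Heisenberg k) : p⁻¹.t = -p.t := rfl

/-- The Heisenberg group law `(v,t) · (v',t') = (v + v', t + t' + ω(v,v') / 2)`. -/
instance : Group (Heisenberg k) :=
  Group.ofLeftAxioms
    (fun a b c => by
      ext1
      · simp [add_assoc]
      · simp only [mul_t, mul_v, omega_add_left, omega_add_right]; ring)
    (fun a => by ext1 <;> simp [omega_zero_left])
    (fun a => by ext1 <;> simp [omega_neg_left, omega_self])

/-- The Korányi norm `‖(v,t)‖ = (|v|⁴ + 16 t²)^{1/4}`. -/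
def koranyi (p : Heisenberg k) : ℝ := (‖p.v‖ ^ 4 + 16 * p.t ^ 2) ^ (1 / 4 : ℝ)

lemma koranyi_nonneg (p : Heisenberg k) : 0 ≤ koranyi p := by
  unfold koranyi; positivity

lemma koranyi_pow_four (p : Heisenberg k) : koranyi p ^ 4 = ‖p.v‖ ^ 4 + 16 * p.t ^ 2 := by
  unfold koranyi
  rw [← Real.rpow_natCast, ← Real.rpow_mul (by positivity)]
  norm_num

lemma koranyi_one : koranyi (1 : Heisenberg k) = 0 := by
  simp [koranyi]

lemma eq_one_of_koranyi_eq_zero {p : Heisenberg k} (h : koranyi p = 0) : p = 1 := by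
  have h4 := koranyi_pow_four p
  rw [h] at h4
  have h1 : ‖p.v‖ ^ 4 = 0 := by nlinarith [sq_nonneg p.t, sq_nonneg (‖p.v‖ ^ 2)]
  have h2 : p.t ^ 2 = 0 := by nlinarith [sq_nonneg p.t, sq_nonneg (‖p.v‖ ^ 2)]
  ext1
  · simpa using h1
  · simpa using h2

lemma koranyi_inv (p : Heisenberg k) : koranyi p⁻¹ = koranyi p := by
  simp [koranyi]

lemma norm_sq_eq_sum (v : EuclideanSpace ℝ (Fin k ⊕ Fin k)) :
    ‖v‖ ^ 2 = ∑ j : Fin k, (v (Sum.inl j) ^ 2 + v (Sum.inr j) ^ 2) := by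
  simp [EuclideanSpace.norm_sq_eq, Finset.sum_add_distrib]

/-- The Cauchy-Schwarz inequality for the Hermitian form `⟨v,w⟩ + i ω(v,w)`. -/
lemma inner_sq_add_omega_sq_le (v w : EuclideanSpace ℝ (Fin k ⊕ Fin k)) :
    inner ℝ v w ^ 2 + omega v w ^ 2 ≤ ‖v‖ ^ 2 * ‖w‖ ^ 2 := by
  set a := inner ℝ v w with ha
  set b := omega v w with hb
  -- `x = a w + b J w`, with `⟨v, x⟩ = a² + b²` and `|x|² = (a² + b²) |w|²`
  let x : EuclideanSpace ℝ (Fin k ⊕ Fin k) := WithLp.toLp 2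
    (Sum.elim (fun j => a * w (Sum.inl j) + b * w (Sum.inr j))
      (fun j => a * w (Sum.inr j) - b * w (Sum.inl j)))
  have h1 : inner ℝ v x = a ^ 2 + b ^ 2 := by
    have e1 : a = ∑ j : Fin k, (v (Sum.inl j) * w (Sum.inl j) + v (Sum.inr j) * w (Sum.inr j)) := by
      rw [ha]
      simp [PiLp.inner_apply, Finset.sum_add_distrib, mul_comm]
    have e2 : inner ℝ v x = ∑ j : Fin k,
        (v (Sum.inl j) * (a * w (Sum.inl j) + b * w (Sum.inr j))
          + v (Sum.inr j) * (a * w (Sum.inr j) - b * w (Sum.inl j))) := by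
      simp [PiLp.inner_apply, Finset.sum_add_distrib, mul_comm, x]
    have e3 : a ^ 2 + b ^ 2 = a * ∑ j : Fin k,
        (v (Sum.inl j) * w (Sum.inl j) + v (Sum.inr j) * w (Sum.inr j)) + b * omega v w := by
      rw [← e1, ← hb]; ring
    rw [e2, e3, omega, Finset.mul_sum, Finset.mul_sum, ← Finset.sum_add_distrib]
    exact Finset.sum_congr rfl fun _ _ => by ring
  have h2 : ‖x‖ ^ 2 = (a ^ 2 + b ^ 2) * ‖w‖ ^ 2 := by
    rw [norm_sq_eq_sum, norm_sq_eq_sum, Finset.mul_sum]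
    exact Finset.sum_congr rfl fun _ _ => by simp [x]; ring
  have h3 : (inner ℝ v x) ^ 2 ≤ ‖v‖ ^ 2 * ‖x‖ ^ 2 := by
    rw [← mul_pow, ← sq_abs]
    exact pow_le_pow_left₀ (abs_nonneg _) (abs_real_inner_le_norm v x) 2
  rw [h1, h2] at h3
  rcases (by positivity : 0 ≤ a ^ 2 + b ^ 2).eq_or_lt with h0 | h0
  · rw [← h0]; positivity
  · exact le_of_mul_le_mul_left (by nlinarith) h0

/-- The Korányi norm is subadditive. -/
lemma koranyi_mul_le (p q : Heisenberg k) : koranyi (p * q) ≤ koranyi p + koranyi q := by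
  let z : Heisenberg k → ℂ := fun p => ⟨‖p.v‖ ^ 2, 4 * p.t⟩
  have hz : ∀ p, ‖z p‖ = koranyi p ^ 2 := fun p => by
    rw [← sq_eq_sq₀ (norm_nonneg _) (by positivity), ← pow_mul, koranyi_pow_four,
      Complex.sq_norm, Complex.normSq_apply]
    simp only [z]; ring
  let c : ℂ := ⟨inner ℝ p.v q.v, omega p.v q.v⟩
  have hsum : z (p * q) = z p + z q + 2 * c := by
    apply Complex.ext
    · simp only [z, c, mul_v, norm_add_sq_real]
      simp; ring
    · simp [z, c]; ring
  have hv : ∀ p : Heisenberg k, ‖p.v‖ ≤ koranyi p := fun p => by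
    refine le_of_pow_le_pow_left₀ (n := 4) (by norm_num) (koranyi_nonneg p) ?_
    rw [koranyi_pow_four]; nlinarith [sq_nonneg p.t]
  have hc : ‖c‖ ≤ koranyi p * koranyi q := by
    refine le_trans ?_ (mul_le_mul (hv p) (hv q) (norm_nonneg _) (koranyi_nonneg p))
    rw [← sq_le_sq₀ (norm_nonneg _) (by positivity), Complex.sq_norm, Complex.normSq_apply, mul_pow]
    have := inner_sq_add_omega_sq_le p.v q.v
    simp only [c]; nlinarith
  have hp := koranyi_nonneg p
  have hq := koranyi_nonneg q
  rw [← sq_le_sq₀ (koranyi_nonneg _) (by positivity), ← hz, hsum]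
  calc ‖z p + z q + 2 * c‖ ≤ ‖z p‖ + ‖z q‖ + ‖2 * c‖ := norm_add₃_le
    _ = koranyi p ^ 2 + koranyi q ^ 2 + 2 * ‖c‖ := by rw [hz, hz, norm_mul]; simp
    _ ≤ (koranyi p + koranyi q) ^ 2 := by nlinarith

/-- The Korányi distance `d(p,q) = ‖q⁻¹ · p‖`; the topology is the one it induces. -/
instance : MetricSpace (Heisenberg k) where
  dist p q := koranyi (q⁻¹ * p)
  dist_self p := by simp [koranyi_one]
  dist_comm p q := by rw [← koranyi_inv]; simp
  dist_triangle p q r := by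
    have h : r⁻¹ * p = (r⁻¹ * q) * (q⁻¹ * p) := by group
    show koranyi (r⁻¹ * p) ≤ koranyi (q⁻¹ * p) + koranyi (r⁻¹ * q)
    rw [h, add_comm]
    exact koranyi_mul_le _ _
  eq_of_dist_eq_zero {p q} h := by
    have h' : q⁻¹ * p = 1 := eq_one_of_koranyi_eq_zero h
    exact (inv_mul_eq_one.mp h').symm

lemma dist_def (p q : Heisenberg k) : dist p q = koranyi (q⁻¹ * p) := rfl

/-- The Borel σ-algebra of the Korányi distance. -/
instance : MeasurableSpace (Heisenberg k) := borel _

instance : BorelSpace (Heisenberg k) := ⟨rfl⟩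

/-- The vertical subgroup `𝕍_ν = (ℝν)^⊥ × ℝ`. -/
def verticalSubgroup (ν : EuclideanSpace ℝ (Fin k ⊕ Fin k)) : Subgroup (Heisenberg k) where
  carrier := {p | p.v ∈ (Submodule.span ℝ {ν})ᗮ}
  mul_mem' {_ _} hp hq := (Submodule.span ℝ {ν})ᗮ.add_mem hp hq
  one_mem' := (Submodule.span ℝ {ν})ᗮ.zero_mem
  inv_mem' {_} hp := (Submodule.span ℝ {ν})ᗮ.neg_mem hp

/-- The horizontal subgroup `𝕃_ν = ℝν × {0}`. -/
def horizontalSubgroup (ν : EuclideanSpace ℝ (Fin k ⊕ Fin k)) : Subgroup (Heisenberg k) where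
  carrier := {p | p.v ∈ Submodule.span ℝ {ν} ∧ p.t = 0}
  mul_mem' {p q} hp hq := by
    refine ⟨Submodule.add_mem _ hp.1 hq.1, ?_⟩
    obtain ⟨a, ha⟩ := Submodule.mem_span_singleton.mp hp.1
    obtain ⟨b, hb⟩ := Submodule.mem_span_singleton.mp hq.1
    simp [hp.2, hq.2, ← ha, ← hb, omega_smul_left, omega_smul_right, omega_self]
  one_mem' := ⟨Submodule.zero_mem _, rfl⟩
  inv_mem' {p} hp := ⟨Submodule.neg_mem _ hp.1, by simp [hp.2]⟩

/-- The projection `π_{𝕍_ν}` onto the vertical subgroup, for `|ν| = 1`. -/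
def projV (ν : EuclideanSpace ℝ (Fin k ⊕ Fin k)) (p : Heisenberg k) : Heisenberg k :=
  ⟨p.v - inner ℝ p.v ν • ν, p.t - omega p.v (inner ℝ p.v ν • ν) / 2⟩

/-- The projection `π_{𝕃_ν}` onto the horizontal subgroup, for `|ν| = 1`. -/
def projL (ν : EuclideanSpace ℝ (Fin k ⊕ Fin k)) (p : Heisenberg k) : Heisenberg k :=
  ⟨inner ℝ p.v ν • ν, 0⟩

lemma projV_mem {ν : EuclideanSpace ℝ (Fin k ⊕ Fin k)} (hν : ‖ν‖ = 1) (p : Heisenberg k) :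
    projV ν p ∈ verticalSubgroup ν := by
  show p.v - inner ℝ p.v ν • ν ∈ (Submodule.span ℝ {ν})ᗮ
  rw [Submodule.mem_orthogonal_singleton_iff_inner_left, inner_sub_left, inner_smul_left,
    real_inner_self_eq_norm_sq, hν]
  simp

lemma projL_mem (ν : EuclideanSpace ℝ (Fin k ⊕ Fin k)) (p : Heisenberg k) :
    projL ν p ∈ horizontalSubgroup ν :=
  ⟨Submodule.smul_mem _ _ (Submodule.mem_span_singleton_self ν), rfl⟩

lemma projV_mul_projL (ν : EuclideanSpace ℝ (Fin k ⊕ Fin k)) (p : Heisenberg k) :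
    projV ν p * projL ν p = p := by
  ext1
  · simp [projV, projL]
  · simp only [projV, projL, mul_t, sub_eq_add_neg, omega_add_left, omega_neg_left, omega_self]
    ring

/-- `projV ν p` and `projL ν p` are the components of the unique decomposition of `p` as a product
of an element of `𝕍_ν` and an element of `𝕃_ν`. -/
lemma eq_projV_projL_of_mul_eq {ν : EuclideanSpace ℝ (Fin k ⊕ Fin k)} (hν : ‖ν‖ = 1)
    {p a b : Heisenberg k} (ha : a ∈ verticalSubgroup ν) (hb : b ∈ horizontalSubgroup ν)
    (h : a * b = p) : a = projV ν p ∧ b = projL ν p := by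
  have hbL : b = projL ν p := by
    obtain ⟨c, hc⟩ := Submodule.mem_span_singleton.mp hb.1
    have hav : inner ℝ a.v ν = 0 := Submodule.mem_orthogonal_singleton_iff_inner_left.mp ha
    ext1
    · simp [projL, ← h, ← hc, inner_add_left, hav, inner_smul_left, hν]
    · exact hb.2
  refine ⟨?_, hbL⟩
  rw [hbL] at h
  exact mul_right_cancel (h.trans (projV_mul_projL ν p).symm)

/-- The cone `C_λ(ν) = {p : λ ‖p‖ < ‖π_{𝕃_ν}(p)‖}`. -/
def cone (lam : ℝ) (ν : EuclideanSpace ℝ (Fin k ⊕ Fin k)) : Set (Heisenberg k) :=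
  {p | lam * koranyi p < koranyi (projL ν p)}

/-- Intrinsic `(λ,ν)`-Lipschitz graphs (of codimension one). -/
def IsIntrinsicLipschitzGraphDir (lam : ℝ) (ν : EuclideanSpace ℝ (Fin k ⊕ Fin k))
    (Γ : Set (Heisenberg k)) : Prop :=
  lam ∈ Set.Ioo (0 : ℝ) 1 ∧ ν ∈ Metric.sphere (0 : EuclideanSpace ℝ (Fin k ⊕ Fin k)) 1 ∧
    projV ν '' Γ = verticalSubgroup ν ∧
    ∀ p ∈ Γ, ((fun q => p * q) '' cone lam ν) ∩ Γ = ∅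

/-- Intrinsic `λ`-Lipschitz graphs (of codimension one). -/
def IsIntrinsicLipschitzGraph (lam : ℝ) (Γ : Set (Heisenberg k)) : Prop :=
  ∃ ν, IsIntrinsicLipschitzGraphDir lam ν Γ

/-- `E` is `C`-Ahlfors regular with dimension `s`, with respect to the `s`-dimensional Hausdorff
measure and the open balls of the Korányi distance. -/
def IsAhlforsRegular (s C : ℝ) (E : Set (Heisenberg k)) : Prop :=
  IsClosed E ∧ ∀ p ∈ E, ∀ r : ℝ, 0 < r →
    ENNReal.ofReal (C⁻¹ * r ^ s) ≤ μH[s] (E ∩ Metric.ball p r) ∧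
    μH[s] (E ∩ Metric.ball p r) ≤ ENNReal.ofReal (C * r ^ s)

end

end Heisenberg

/-! The graph meets every fibre `q · 𝕃_ν` in exactly one point `γ q`. The cone condition gives `(1 -
λ) d(x, y) ≤ ‖π_𝕍(x⁻¹ y)‖ ≤ 2 d(x, y)` for `x, y ∈ Γ`. So `γ⁻¹(B(x, ρ))` is squeezed between two
tubes of fibres around the fibre of `x`, of radii comparable to `ρ`. Pushing forward by `γ` the
Lebesgue measure of a slab of width `h` therefore gives a measure `μ` on `Γ` with `μ(B(x, ρ)) ≈ h
ρ^(2k+1)` for `ρ` small relative to `h` (`exists_measure_ball_bounds`). No Haar measure on `𝕍_ν` is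
needed.

The volume of a tube (`exists_lebesgue_tube_bounds`) comes from the bi-invariance of Lebesgue
measure. A tube of radius `ρ` is moved to the identity and cut into about `h / ρ` translates of a
piece comparable to a Korányi ball, whose volume is about `ρ^(2k+2)`. Only volumes of balls enter,
so the constants do not depend on `ν`.

The mass distribution principle and a Vitali covering then convert the bounds on `μ` into the two
bounds on `μH[2k+1]`. With `h = 4 r`, the factor `h` cancels. -/

/-! ### Comparing a measure with Hausdorff measure through its values on balls. -/

/-- A measure whose small balls satisfy `μ (ball x ρ) ≤ b ρ ^ s` is at most a multiple of the
`s`-dimensional Hausdorff measure. -/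
lemma MeasureTheory.Measure.le_smul_hausdorffMeasure_of_ball_le {X : Type*} [MetricSpace X]
    [MeasurableSpace X] [BorelSpace X] {s : ℝ} (hs : 0 < s) (μ : Measure X) {b R : ℝ} (hb : 0 < b)
    (hR : 0 < R)
    (h : ∀ x : X, ∀ ρ, 0 < ρ → ρ ≤ R → μ (Metric.ball x ρ) ≤ ENNReal.ofReal (b * ρ ^ s)) :
    μ ≤ ENNReal.ofReal b • μH[s] := by
  have hb0 : ENNReal.ofReal b ≠ 0 := by simpa using hb
  have hscale : (ENNReal.ofReal b)⁻¹ • μ ≤ μH[s] → μ ≤ ENNReal.ofReal b • μH[s] := fun H E => by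
    have := H E
    rw [smul_apply, smul_eq_mul] at this ⊢
    rwa [ENNReal.inv_mul_le_iff hb0 ENNReal.ofReal_ne_top] at this
  refine hscale (le_hausdorffMeasure s _ (ENNReal.ofReal (R / 2)) (by simpa using hR)
    fun E hE => ?_)
  rw [smul_apply, smul_eq_mul, ENNReal.inv_mul_le_iff hb0 ENNReal.ofReal_ne_top]
  rcases E.eq_empty_or_nonempty with rfl | ⟨e, he⟩
  · simp
  have hfin : Metric.ediam E ≠ ⊤ := ne_top_of_le_ne_top ENNReal.ofReal_ne_top hE
  set d := Metric.diam E with hd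
  have hd0 : 0 ≤ d := Metric.diam_nonneg
  have hdE : Metric.ediam E = ENNReal.ofReal d := (ENNReal.ofReal_toReal hfin).symm
  have hdR : d < R := by
    rw [hdE, ENNReal.ofReal_le_ofReal_iff (by positivity)] at hE
    linarith
  rw [hdE, ENNReal.ofReal_rpow_of_nonneg hd0 hs.le, ← ENNReal.ofReal_mul hb.le]
  -- `E` lies in `ball e ρ` for every `ρ > d`, but possibly not for `ρ = d`, hence the limit `ρ ↓
  -- d`. This also covers `d = 0`. The threshold `R / 2` above leaves room for radii between `d` and
  -- `R`.
  have hbound : ∀ᶠ ρ in nhdsWithin d (Set.Ioi d), μ E ≤ ENNReal.ofReal (b * ρ ^ s) := by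
    filter_upwards [Ioc_mem_nhdsGT hdR] with ρ hρ
    refine (measure_mono fun y hy => ?_).trans (h e ρ (hd0.trans_lt hρ.1) hρ.2)
    exact (Metric.dist_le_diam_of_mem' hfin hy he).trans_lt hρ.1
  have hcont : Continuous fun ρ : ℝ => ENNReal.ofReal (b * ρ ^ s) :=
    ENNReal.continuous_ofReal.comp (continuous_const.mul (Real.continuous_rpow_const hs.le))
  exact ge_of_tendsto hcont.continuousWithinAt.tendsto hbound

/-- A set all of whose points satisfy `a ρ ^ s ≤ μ (ball x ρ)` at scales up to `r` has local
`s`-dimensional Hausdorff measure controlled by `μ`. -/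
lemma MeasureTheory.Measure.hausdorffMeasure_inter_ball_le_of_le_ball {X : Type*} [MetricSpace X]
    [TopologicalSpace.SeparableSpace X] [MeasurableSpace X] [BorelSpace X] {s : ℝ} (hs : 0 < s)
    (μ : Measure X) {a r : ℝ} (ha : 0 < a) (hr : 0 < r) {E : Set X} (p : X)
    (h : ∀ x ∈ E, ∀ ρ, 0 < ρ → ρ ≤ r → ENNReal.ofReal (a * ρ ^ s) ≤ μ (Metric.ball x ρ)) :
    ENNReal.ofReal a * μH[s] (E ∩ Metric.ball p r) ≤
      ENNReal.ofReal (10 ^ s) * μ (Metric.ball p (2 * r)) := by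
  let δ : ℕ → ℝ := fun n => r / (n + 1)
  have hδ : ∀ n, 0 < δ n := fun n => by positivity
  have hδr : ∀ n, δ n ≤ r := fun n => div_le_self hr.le (by linarith [n.cast_nonneg (α := ℝ)])
  -- Vitali at the single scale `δ n`: disjoint balls centred in the set, whose 5-fold enlargements
  -- cover it. The enlargements have diameter at most `10 δ n`, the source of `10 ^ s`.
  choose u hu hdisj hcov using fun n =>
    Vitali.exists_disjoint_subfamily_covering_enlargement_closedBall (E ∩ Metric.ball p r) id
      (fun _ => δ n) (δ n) (fun _ _ => le_rfl) 5 (by norm_num)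
  have hcount : ∀ n, (u n).Countable := fun n =>
    (hdisj n).countable_of_nonempty_interior fun x _ =>
      ⟨x, Metric.ball_subset_interior_closedBall (Metric.mem_ball_self (hδ n))⟩
  have : ∀ n, Countable (u n) := fun n => (hcount n).to_subtype
  have hdiam : ∀ n (x : X), Metric.ediam (Metric.closedBall x (5 * δ n)) ≤
      ENNReal.ofReal (10 * δ n) := fun n x => by
    refine Metric.ediam_le fun y hy z hz => ?_
    rw [edist_dist]
    refine ENNReal.ofReal_le_ofReal ((dist_triangle_right y z x).trans ?_)
    linarith [Metric.mem_closedBall.mp hy, Metric.mem_closedBall.mp hz]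
  have hlim : Filter.Tendsto (fun n => ENNReal.ofReal (10 * δ n)) Filter.atTop (nhds 0) := by
    have h1 : Filter.Tendsto (fun n => 10 * δ n) Filter.atTop (nhds (10 * 0)) :=
      Filter.Tendsto.const_mul 10 (by
        simpa [δ, div_eq_mul_inv] using
          (tendsto_one_div_add_atTop_nhds_zero_nat (𝕜 := ℝ)).const_mul r)
    have h2 := (ENNReal.continuous_ofReal.tendsto _).comp h1
    rwa [mul_zero, ENNReal.ofReal_zero] at h2
  have hH := hausdorffMeasure_le_liminf_tsum s (E ∩ Metric.ball p r) _ hlim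
    (fun n (x : u n) => Metric.closedBall (x : X) (5 * δ n))
    (Filter.Eventually.of_forall fun n x => hdiam n x)
    (Filter.Eventually.of_forall fun n x hx => by
      obtain ⟨y, hy, hxy⟩ := hcov n x hx
      exact Set.mem_iUnion.mpr ⟨⟨y, hy⟩, hxy (Metric.mem_closedBall_self (hδ n).le)⟩)
  refine (mul_le_mul_right hH _).trans ?_
  rw [← ENNReal.liminf_const_mul_of_ne_top ENNReal.ofReal_ne_top]
  refine (Filter.liminf_le_liminf (v := fun _ : ℕ => ENNReal.ofReal (10 ^ s) *
    μ (Metric.ball p (2 * r))) (Filter.Eventually.of_forall fun n => ?_)).trans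
    (Filter.liminf_const _).le
  calc ENNReal.ofReal a * ∑' x : u n, Metric.ediam (Metric.closedBall (x : X) (5 * δ n)) ^ s
      ≤ ∑' x : u n, ENNReal.ofReal (10 ^ s) * μ (Metric.closedBall (x : X) (δ n)) := by
        rw [← ENNReal.tsum_mul_left]
        refine ENNReal.tsum_le_tsum fun x => ?_
        calc ENNReal.ofReal a * Metric.ediam (Metric.closedBall (x : X) (5 * δ n)) ^ s
            ≤ ENNReal.ofReal a * ENNReal.ofReal (10 * δ n) ^ s := by
              gcongr; exact hdiam n x
          _ = ENNReal.ofReal (10 ^ s) * ENNReal.ofReal (a * δ n ^ s) := by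
              have := hδ n
              rw [ENNReal.ofReal_rpow_of_nonneg (by positivity) hs.le,
                Real.mul_rpow (by norm_num) this.le, ← ENNReal.ofReal_mul ha.le,
                ← ENNReal.ofReal_mul (by positivity)]
              congr 1; ring
          _ ≤ _ := by
              gcongr
              exact (h x (hu n x.2).1 _ (hδ n) (hδr n)).trans
                (measure_mono Metric.ball_subset_closedBall)
    _ = ENNReal.ofReal (10 ^ s) * μ (⋃ x ∈ u n, Metric.closedBall x (δ n)) := by
        rw [ENNReal.tsum_mul_left, measure_biUnion (f := fun x => Metric.closedBall x (δ n)) (hcount n)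
          (hdisj n) fun _ _ => Metric.isClosed_closedBall.measurableSet]
    _ ≤ _ := by
        -- The centres lie in `ball p r` and `δ n ≤ r`, so the disjoint balls stay inside `ball p (2
        -- * r)`.
        gcongr
        refine Set.iUnion₂_subset fun x hx y hy => ?_
        have h1 := Metric.mem_ball.mp (hu n hx).2
        have h2 := Metric.mem_closedBall.mp hy
        have := hδr n
        exact Metric.mem_ball.mpr ((dist_triangle y x p).trans_lt (by linarith))

namespace Heisenberg

noncomputable section

variable {k : ℕ}

/-! ### Topology of the Korányi distance. -/

lemma continuous_omega :
    Continuous fun x : EuclideanSpace ℝ (Fin k ⊕ Fin k) × EuclideanSpace ℝ (Fin k ⊕ Fin k) =>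
      omega x.1 x.2 := by
  unfold omega
  fun_prop

lemma norm_v_le_koranyi (p : Heisenberg k) : ‖p.v‖ ≤ koranyi p := by
  refine le_of_pow_le_pow_left₀ (n := 4) (by norm_num) (koranyi_nonneg p) ?_
  rw [koranyi_pow_four]; nlinarith [sq_nonneg p.t]

lemma abs_t_le_koranyi (p : Heisenberg k) : 4 * |p.t| ≤ koranyi p ^ 2 := by
  refine le_of_pow_le_pow_left₀ (n := 2) (by norm_num) (by positivity) ?_
  rw [← pow_mul, koranyi_pow_four, mul_pow, sq_abs]
  nlinarith [sq_nonneg (‖p.v‖ ^ 2)]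

lemma continuous_v : Continuous (v : Heisenberg k → _) := by
  refine LipschitzWith.continuous (K := 1) (LipschitzWith.of_dist_le_mul fun p q => ?_)
  have h := norm_v_le_koranyi (q⁻¹ * p)
  rw [dist_def, dist_eq_norm]
  simpa [add_comm, sub_eq_add_neg] using h

/-- The distance controls `(q⁻¹ * p).t`, not `p.t - q.t`; the two differ by `ω(q.v, p.v) / 2`, which
tends to `ω(q.v, q.v) / 2 = 0` as `p → q`. -/
lemma continuous_t : Continuous (t : Heisenberg k → ℝ) := by
  refine continuous_iff_continuousAt.mpr fun q => ?_
  have h1 : Filter.Tendsto (fun p : Heisenberg k => (q⁻¹ * p).t) (nhds q) (nhds 0) := by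
    refine squeeze_zero_norm (a := fun p => dist p q ^ 2) (fun p => ?_) ?_
    · have := abs_t_le_koranyi (q⁻¹ * p)
      rw [Real.norm_eq_abs, dist_def]
      linarith [abs_nonneg (q⁻¹ * p).t]
    · have : Continuous fun p : Heisenberg k => dist p q ^ 2 := by fun_prop
      simpa using this.tendsto q
  have h2 : Filter.Tendsto (fun p : Heisenberg k => omega q.v p.v / 2) (nhds q) (nhds 0) := by
    have : Continuous fun p : Heisenberg k => omega q.v p.v / 2 :=
      (continuous_omega.comp (continuous_const.prodMk continuous_v)).div_const 2
    simpa [omega_self] using this.tendsto q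
  have h3 := (h1.add h2).const_add q.t
  simp only [add_zero] at h3
  refine h3.congr fun p => ?_
  simp only [mul_t, inv_t, inv_v, omega_neg_left]
  ring

/-- The Korányi distance induces the product topology of `ℝ^{2k} × ℝ`. -/
def homeomorphProd : Heisenberg k ≃ₜ EuclideanSpace ℝ (Fin k ⊕ Fin k) × ℝ where
  toFun p := (p.v, p.t)
  invFun x := ⟨x.1, x.2⟩
  left_inv _ := rfl
  right_inv _ := rfl
  continuous_toFun := continuous_v.prodMk continuous_t
  continuous_invFun := by
    refine continuous_iff_continuousAt.mpr fun x => tendsto_iff_dist_tendsto_zero.mpr ?_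
    have h : Continuous fun y : EuclideanSpace ℝ (Fin k ⊕ Fin k) × ℝ =>
        dist (⟨y.1, y.2⟩ : Heisenberg k) ⟨x.1, x.2⟩ := by
      simp only [dist_def, koranyi, mul_v, mul_t, inv_v, inv_t]
      have : Continuous fun y : EuclideanSpace ℝ (Fin k ⊕ Fin k) × ℝ => omega (-x.1) y.1 :=
        continuous_omega.comp (continuous_const.prodMk continuous_fst)
      refine Continuous.rpow_const (by fun_prop) fun _ => Or.inr (by norm_num)
    simpa using h.tendsto x

lemma continuous_mk {X : Type*} [TopologicalSpace X]
    {f : X → EuclideanSpace ℝ (Fin k ⊕ Fin k)} {g : X → ℝ} (hf : Continuous f)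
    (hg : Continuous g) : Continuous fun x => (⟨f x, g x⟩ : Heisenberg k) :=
  homeomorphProd.symm.continuous.comp (hf.prodMk hg)

instance : SecondCountableTopology (Heisenberg k) :=
  homeomorphProd.isInducing.secondCountableTopology

lemma continuous_mul_left' (p : Heisenberg k) : Continuous fun q => p * q :=
  (Isometry.of_dist_eq fun x y => by
    rw [dist_def, dist_def, mul_inv_rev, mul_assoc, inv_mul_cancel_left]).continuous

lemma continuous_projV (ν : EuclideanSpace ℝ (Fin k ⊕ Fin k)) : Continuous (projV ν) := by
  have h : Continuous fun p : Heisenberg k => inner ℝ p.v ν • ν := by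
    have := continuous_v (k := k)
    fun_prop
  exact continuous_mk (continuous_v.sub h)
    (continuous_t.sub ((continuous_omega.comp (continuous_v.prodMk h)).div_const 2))

lemma koranyi_eq_dist_one (p : Heisenberg k) : koranyi p = dist p 1 := by
  rw [dist_def]; simp

lemma continuous_koranyi : Continuous (koranyi : Heisenberg k → ℝ) := by
  simp only [funext koranyi_eq_dist_one]
  fun_prop

/-! ### Lebesgue measure: invariance and volume of balls. -/

/-- The Lebesgue measure of `ℝ^{2k} × ℝ`, a bi-invariant measure on the Heisenberg group. -/
def lebesgue : Measure (Heisenberg k) :=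
  (volume : Measure (EuclideanSpace ℝ (Fin k ⊕ Fin k) × ℝ)).map homeomorphProd.symm

lemma measurePreserving_homeomorphProd :
    MeasurePreserving (homeomorphProd (k := k)) lebesgue volume := by
  refine ⟨homeomorphProd.continuous.measurable, ?_⟩
  rw [lebesgue, map_map homeomorphProd.continuous.measurable
    homeomorphProd.symm.continuous.measurable]
  simp

/-- By Fubini, since each vertical line is only translated. Left and right translations of the group
both have this form. -/
lemma measurePreserving_of_shear (a : EuclideanSpace ℝ (Fin k ⊕ Fin k))
    {g : EuclideanSpace ℝ (Fin k ⊕ Fin k) → ℝ} (hg : Continuous g) :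
    MeasurePreserving (fun q : Heisenberg k => (⟨a + q.v, g q.v + q.t⟩ : Heisenberg k))
      lebesgue lebesgue := by
  have h : MeasurePreserving
      (fun x : EuclideanSpace ℝ (Fin k ⊕ Fin k) × ℝ => (a + x.1, g x.1 + x.2)) volume volume :=
    (measurePreserving_add_left volume a).skew_product
      (g := fun v t => g v + t) (by fun_prop)
      (Filter.Eventually.of_forall fun v => (measurePreserving_add_left volume (g v)).map_eq)
  have h' : MeasurePreserving (homeomorphProd (k := k)).symm volume lebesgue :=
    ⟨homeomorphProd.symm.continuous.measurable, rfl⟩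
  exact h'.comp (h.comp measurePreserving_homeomorphProd)

lemma measurePreserving_mul_left' (p : Heisenberg k) :
    MeasurePreserving (fun q => p * q) lebesgue lebesgue := by
  convert measurePreserving_of_shear p.v (g := fun v => p.t + omega p.v v / 2)
    (by have := continuous_omega.comp (continuous_const (y := p.v).prodMk continuous_id)
        exact continuous_const.add (this.div_const 2)) using 2 with q
  ext1
  · rfl
  · simp only [mul_t]; ring

lemma measurePreserving_mul_right' (p : Heisenberg k) :
    MeasurePreserving (fun q => q * p) lebesgue lebesgue := by
  convert measurePreserving_of_shear p.v (g := fun v => p.t + omega v p.v / 2)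
    (by have := continuous_omega.comp (continuous_id.prodMk (continuous_const (y := p.v)))
        exact continuous_const.add (this.div_const 2)) using 2 with q
  ext1
  · simp [add_comm]
  · simp only [mul_t]; ring

lemma lebesgue_box (R T : ℝ) :
    lebesgue {p : Heisenberg k | ‖p.v‖ < R ∧ |p.t| < T} =
      volume (Metric.ball (0 : EuclideanSpace ℝ (Fin k ⊕ Fin k)) R) * ENNReal.ofReal (2 * T) := by
  have h : {p : Heisenberg k | ‖p.v‖ < R ∧ |p.t| < T} = homeomorphProd ⁻¹'
      (Metric.ball (0 : EuclideanSpace ℝ (Fin k ⊕ Fin k)) R ×ˢ Metric.ball (0 : ℝ) T) := by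
    ext p; simp [homeomorphProd]
  rw [h, measurePreserving_homeomorphProd.measure_preimage
    (Metric.isOpen_ball.prod Metric.isOpen_ball).measurableSet.nullMeasurableSet,
    volume_eq_prod, prod_prod, Real.volume_ball]

/-- The Lebesgue measure of a Korányi ball of radius `r` is comparable to `r ^ (2 k + 2)`. -/
lemma exists_lebesgue_ball_bounds (k : ℕ) : ∃ c C : ℝ, 0 < c ∧ 0 < C ∧ ∀ r : ℝ, 0 < r →
    ENNReal.ofReal (c * r ^ (2 * k + 2)) ≤ lebesgue (Metric.ball (1 : Heisenberg k) r) ∧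
      lebesgue (Metric.ball (1 : Heisenberg k) r) ≤ ENNReal.ofReal (C * r ^ (2 * k + 2)) := by
  set b := (volume (Metric.ball (0 : EuclideanSpace ℝ (Fin k ⊕ Fin k)) 1)).toReal with hb
  have hb' : volume (Metric.ball (0 : EuclideanSpace ℝ (Fin k ⊕ Fin k)) 1) = ENNReal.ofReal b :=
    (ENNReal.ofReal_toReal measure_ball_lt_top.ne).symm
  have hb0 : 0 < b := ENNReal.toReal_pos (Metric.measure_ball_pos _ _ one_pos).ne'
    measure_ball_lt_top.ne
  have hbox : ∀ R T : ℝ, 0 < R → lebesgue {p : Heisenberg k | ‖p.v‖ < R ∧ |p.t| < T} =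
      ENNReal.ofReal (R ^ (2 * k) * b * (2 * T)) := fun R T hR => by
    have hrank : Module.finrank ℝ (EuclideanSpace ℝ (Fin k ⊕ Fin k)) = 2 * k := by simp [two_mul]
    rw [lebesgue_box, addHaar_ball_of_pos _ _ hR, hb', hrank,
      ← ENNReal.ofReal_mul (by positivity), ← ENNReal.ofReal_mul (by positivity)]
  -- The ball is squeezed between the cylinders `|v| < r/2, |t| < r²/8` and `|v| < r, |t| < r²`; the
  -- inner one fits because `1/16 + 16/64 < 1`.
  refine ⟨b * (1 / 2) ^ (2 * k) / 4, 2 * b, by positivity, by positivity, fun r hr => ⟨?_, ?_⟩⟩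
  · refine le_trans (le_of_eq ?_) ((hbox (r / 2) (r ^ 2 / 8) (by positivity)).symm.le.trans
      (measure_mono fun p hp => ?_))
    · congr 1; rw [div_eq_mul_one_div r 2, mul_pow]; ring
    · rw [Metric.mem_ball, ← koranyi_eq_dist_one]
      refine lt_of_pow_lt_pow_left₀ 4 hr.le ?_
      rw [koranyi_pow_four]
      have h1 : ‖p.v‖ ^ 4 < (r / 2) ^ 4 := pow_lt_pow_left₀ hp.1 (norm_nonneg _) (by norm_num)
      have h2 : |p.t| ^ 2 < (r ^ 2 / 8) ^ 2 := pow_lt_pow_left₀ hp.2 (abs_nonneg _) (by norm_num)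
      rw [sq_abs] at h2
      have : 0 < r ^ 4 := by positivity
      nlinarith
  · refine (measure_mono fun p hp => ?_).trans ((hbox r (r ^ 2) hr).le.trans (le_of_eq ?_))
    · rw [Metric.mem_ball, ← koranyi_eq_dist_one] at hp
      refine ⟨(norm_v_le_koranyi p).trans_lt hp, ?_⟩
      have h1 := abs_t_le_koranyi p
      have h2 := pow_lt_pow_left₀ hp (koranyi_nonneg p) two_ne_zero
      linarith [abs_nonneg p.t]
    · congr 1; ring

/-! ### Metric and algebraic properties of the projections. -/

lemma koranyi_projL {ν : EuclideanSpace ℝ (Fin k ⊕ Fin k)} (hν : ‖ν‖ = 1) (p : Heisenberg k) :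
    koranyi (projL ν p) = |inner ℝ p.v ν| := by
  refine (pow_left_inj₀ (koranyi_nonneg _) (abs_nonneg _) (four_ne_zero)).mp ?_
  rw [koranyi_pow_four]
  simp [projL, norm_smul, hν]

lemma abs_inner_le_koranyi {ν : EuclideanSpace ℝ (Fin k ⊕ Fin k)} (hν : ‖ν‖ = 1)
    (p : Heisenberg k) : |inner ℝ p.v ν| ≤ koranyi p := by
  have h := abs_real_inner_le_norm p.v ν
  rw [hν, mul_one] at h
  exact h.trans (norm_v_le_koranyi p)

lemma koranyi_projV_le {ν : EuclideanSpace ℝ (Fin k ⊕ Fin k)} (hν : ‖ν‖ = 1) (p : Heisenberg k) :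
    koranyi (projV ν p) ≤ 2 * koranyi p := by
  have h := koranyi_mul_le p (projL ν p)⁻¹
  rw [mul_inv_eq_of_eq_mul (projV_mul_projL ν p).symm, koranyi_inv, koranyi_projL hν] at h
  linarith [abs_inner_le_koranyi hν p]

lemma koranyi_le_projV_add {ν : EuclideanSpace ℝ (Fin k ⊕ Fin k)} (hν : ‖ν‖ = 1)
    (p : Heisenberg k) : koranyi p ≤ koranyi (projV ν p) + |inner ℝ p.v ν| := by
  have h := koranyi_mul_le (projV ν p) (projL ν p)
  rwa [projV_mul_projL, koranyi_projL hν] at h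

lemma projV_mul_of_mem {ν : EuclideanSpace ℝ (Fin k ⊕ Fin k)} (hν : ‖ν‖ = 1) (p : Heisenberg k)
    {l : Heisenberg k} (hl : l ∈ horizontalSubgroup ν) : projV ν (p * l) = projV ν p :=
  (eq_projV_projL_of_mul_eq hν (projV_mem hν p) (mul_mem (projL_mem ν p) hl)
    (by rw [← mul_assoc, projV_mul_projL])).1.symm

/-- Although `projV ν` is not a homomorphism, it depends only on the coset `p · 𝕃_ν`, and left
translations permute these cosets. -/
lemma projV_mul_left_congr {ν : EuclideanSpace ℝ (Fin k ⊕ Fin k)} (hν : ‖ν‖ = 1)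
    {p q : Heisenberg k} (h : projV ν p = projV ν q) (x : Heisenberg k) :
    projV ν (x * p) = projV ν (x * q) := by
  have hp : x * p = x * q * ((projL ν q)⁻¹ * projL ν p) := by
    conv_lhs => rw [← projV_mul_projL ν p, h, eq_mul_inv_of_mul_eq (projV_mul_projL ν q)]
    group
  rw [hp, projV_mul_of_mem hν _ (mul_mem (inv_mem (projL_mem ν q)) (projL_mem ν p))]

lemma projV_one (ν : EuclideanSpace ℝ (Fin k ⊕ Fin k)) : projV ν (1 : Heisenberg k) = 1 := by
  ext1 <;> simp [projV, omega_zero_left]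

/-! ### Volume of tubes. -/

/-- The points whose fibre along `𝕃_ν` is at distance less than `ρ` from the fibre of `p`, in the
sense of the projection to `𝕍_ν`, and whose `ν`-coordinate lies in `[a, a + h)`. -/
def tube (ν : EuclideanSpace ℝ (Fin k ⊕ Fin k)) (p : Heisenberg k) (ρ a h : ℝ) :
    Set (Heisenberg k) :=
  {q | koranyi (projV ν (p⁻¹ * q)) < ρ ∧ inner ℝ q.v ν ∈ Set.Ico a (a + h)}

lemma measurableSet_slab (ν : EuclideanSpace ℝ (Fin k ⊕ Fin k)) (a h : ℝ) :
    MeasurableSet {q : Heisenberg k | inner ℝ q.v ν ∈ Set.Ico a (a + h)} :=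
  (continuous_v.inner continuous_const).measurable measurableSet_Ico

lemma measurableSet_tube (ν : EuclideanSpace ℝ (Fin k ⊕ Fin k)) (p : Heisenberg k) (ρ a h : ℝ) :
    MeasurableSet (tube ν p ρ a h) :=
  (isOpen_lt (continuous_koranyi.comp ((continuous_projV ν).comp (continuous_mul_left' p⁻¹)))
    continuous_const).measurableSet.inter (measurableSet_slab ν a h)

/-- The volume-preserving map `q ↦ p⁻¹ * q * l`, with `l ∈ 𝕃_ν`, carries one tube to the other: the
left factor recentres the fibres, while `l` shifts the `ν`-coordinate without changing the fibre. -/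
lemma lebesgue_tube_eq {ν : EuclideanSpace ℝ (Fin k ⊕ Fin k)} (hν : ‖ν‖ = 1) (p : Heisenberg k)
    (ρ a h b : ℝ) : lebesgue (tube ν p ρ a h) = lebesgue (tube ν 1 ρ b h) := by
  -- Left multiplication by `p⁻¹` lowers the `ν`-coordinate by `⟨p.v, ν⟩`; `l` restores this and
  -- moves `a` to `b`.
  set l : Heisenberg k := ⟨(inner ℝ p.v ν - a + b) • ν, 0⟩ with hl
  have hlmem : l ∈ horizontalSubgroup ν :=
    ⟨Submodule.smul_mem _ _ (Submodule.mem_span_singleton_self ν), rfl⟩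
  have hmp := (measurePreserving_mul_right' l).comp (measurePreserving_mul_left' p⁻¹)
  rw [← hmp.measure_preimage (measurableSet_tube ν 1 ρ b h).nullMeasurableSet]
  congr 1
  ext q
  have hin : inner ℝ (p⁻¹ * q * l).v ν = inner ℝ q.v ν - a + b := by
    simp only [mul_v, inv_v, hl, inner_add_left, inner_neg_left, inner_smul_left,
      real_inner_self_eq_norm_sq, hν]
    simp; ring
  simp only [tube, Set.mem_ofPred_eq, Set.mem_preimage, Function.comp_apply, inv_one, one_mul, hin,
    projV_mul_of_mem hν _ hlmem, Set.mem_Ico]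
  refine and_congr_right fun _ => ⟨fun h => ⟨?_, ?_⟩, fun h => ⟨?_, ?_⟩⟩ <;> linarith [h.1, h.2]

lemma lebesgue_tube_nat_mul {ν : EuclideanSpace ℝ (Fin k ⊕ Fin k)} (hν : ‖ν‖ = 1) (ρ : ℝ) {h : ℝ}
    (hh : 0 ≤ h) (n : ℕ) :
    lebesgue (tube ν 1 ρ 0 (n * h)) = n * lebesgue (tube ν (1 : Heisenberg k) ρ 0 h) := by
  induction n with
  | zero => simp [tube]
  | succ n ih =>
    have hsplit : tube ν (1 : Heisenberg k) ρ 0 ((n + 1 : ℕ) * h) =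
        tube ν 1 ρ 0 (n * h) ∪ tube ν 1 ρ (n * h) h := by
      have h0 : 0 ≤ n * h := by positivity
      have : Set.Ico (0 : ℝ) (0 + (n + 1 : ℕ) * h) =
          Set.Ico 0 (0 + n * h) ∪ Set.Ico (n * h) (n * h + h) := by
        push_cast
        rw [zero_add, zero_add, Set.Ico_union_Ico_eq_Ico h0 (by linarith), add_mul, one_mul]
      simp only [tube, this, Set.mem_union, and_or_left, Set.ofPred_or]
    have hdisj : Disjoint (tube ν (1 : Heisenberg k) ρ 0 (n * h)) (tube ν 1 ρ (n * h) h) :=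
      Set.disjoint_left.mpr fun q h1 h2 => by
        have h3 := h1.2.2
        have h4 := h2.2.1
        linarith
    rw [hsplit, measure_union hdisj (measurableSet_tube _ _ _ _ _), ih,
      lebesgue_tube_eq hν 1 ρ (n * h) h 0]
    push_cast
    ring

lemma tube_subset_ball {ν : EuclideanSpace ℝ (Fin k ⊕ Fin k)} (hν : ‖ν‖ = 1) (ρ : ℝ) :
    tube ν (1 : Heisenberg k) ρ 0 ρ ⊆ Metric.ball 1 (2 * ρ) := fun q hq => by
  obtain ⟨h1, h2, h3⟩ := hq
  rw [inv_one, one_mul] at h1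
  rw [Metric.mem_ball, ← koranyi_eq_dist_one]
  have := koranyi_le_projV_add hν q
  rw [abs_of_nonneg h2] at this
  linarith

lemma ball_subset_tube {ν : EuclideanSpace ℝ (Fin k ⊕ Fin k)} (hν : ‖ν‖ = 1) (ρ : ℝ) :
    Metric.ball 1 (ρ / 2) ⊆ tube ν (1 : Heisenberg k) ρ (-(ρ / 2)) ρ := fun q hq => by
  rw [Metric.mem_ball, ← koranyi_eq_dist_one] at hq
  have h1 := koranyi_projV_le hν q
  have h2 := abs_lt.mp ((abs_inner_le_koranyi hν q).trans_lt hq)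
  refine ⟨?_, ?_, ?_⟩
  · rw [inv_one, one_mul]; linarith
  · linarith
  · linarith

/-- The Lebesgue measure of a tube of radius `ρ` and length `h ≥ ρ` is comparable to
`h ρ ^ (2 k + 1)`, uniformly in the direction. -/
lemma exists_lebesgue_tube_bounds (k : ℕ) : ∃ c C : ℝ, 0 < c ∧ 0 < C ∧
    ∀ ν : EuclideanSpace ℝ (Fin k ⊕ Fin k), ‖ν‖ = 1 → ∀ (p : Heisenberg k) (ρ a h : ℝ),
      0 < ρ → ρ ≤ h →
      ENNReal.ofReal (c * h * ρ ^ (2 * k + 1)) ≤ lebesgue (tube ν p ρ a h) ∧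
        lebesgue (tube ν p ρ a h) ≤ ENNReal.ofReal (C * h * ρ ^ (2 * k + 1)) := by
  obtain ⟨c, C, hc, hC, H⟩ := exists_lebesgue_ball_bounds k
  refine ⟨c * (1 / 2) ^ (2 * k + 2) / 2, 2 * (C * 2 ^ (2 * k + 2)), by positivity, by positivity,
    fun ν hν p ρ a h hρ hρh => ?_⟩
  have hmono : ∀ {h₁ h₂ : ℝ}, h₁ ≤ h₂ →
      lebesgue (tube ν (1 : Heisenberg k) ρ 0 h₁) ≤ lebesgue (tube ν (1 : Heisenberg k) ρ 0 h₂) :=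
    fun hle => measure_mono fun q hq => ⟨hq.1, hq.2.1, hq.2.2.trans_le (by linarith)⟩
  have hone : 1 ≤ h / ρ := (one_le_div hρ).mpr hρh
  have hpow : ∀ x : ℝ, x * h * ρ ^ (2 * k + 1) = h / ρ * (x * ρ ^ (2 * k + 2)) := fun x => by
    field_simp; ring
  rw [lebesgue_tube_eq hν p ρ a h 0]
  constructor
  -- As `h / ρ ≥ 1`, rounding down or up to an integer number of pieces costs at most a factor 2.
  · have hn : h / ρ / 2 ≤ (⌊h / ρ⌋₊ : ℝ) := by
      have h1 := Nat.lt_floor_add_one (h / ρ)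
      have h2 : (1 : ℝ) ≤ (⌊h / ρ⌋₊ : ℝ) := by exact_mod_cast Nat.le_floor (by simpa using hone)
      linarith
    calc ENNReal.ofReal (c * (1 / 2) ^ (2 * k + 2) / 2 * h * ρ ^ (2 * k + 1))
        = ENNReal.ofReal (h / ρ / 2 * (c * (ρ / 2) ^ (2 * k + 2))) := by
          rw [hpow, div_eq_mul_one_div ρ 2, mul_pow]; congr 1; ring
      _ ≤ ENNReal.ofReal (⌊h / ρ⌋₊ * (c * (ρ / 2) ^ (2 * k + 2))) := by gcongr
      _ = ⌊h / ρ⌋₊ * ENNReal.ofReal (c * (ρ / 2) ^ (2 * k + 2)) := by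
          rw [ENNReal.ofReal_mul (by positivity), ENNReal.ofReal_natCast]
      _ ≤ ⌊h / ρ⌋₊ * lebesgue (tube ν (1 : Heisenberg k) ρ 0 ρ) := by
          gcongr
          rw [← lebesgue_tube_eq hν 1 ρ (-(ρ / 2)) ρ 0]
          exact (H _ (by positivity)).1.trans (measure_mono (ball_subset_tube hν ρ))
      _ ≤ _ := by
          rw [← lebesgue_tube_nat_mul hν ρ hρ.le]
          exact hmono ((le_div_iff₀ hρ).mp (Nat.floor_le (by positivity)))
  · have hn : (⌈h / ρ⌉₊ : ℝ) ≤ 2 * (h / ρ) := by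
      linarith [Nat.ceil_lt_add_one (zero_le_one.trans hone)]
    calc lebesgue (tube ν (1 : Heisenberg k) ρ 0 h)
        ≤ ⌈h / ρ⌉₊ * lebesgue (tube ν (1 : Heisenberg k) ρ 0 ρ) := by
          rw [← lebesgue_tube_nat_mul hν ρ hρ.le]
          exact hmono ((div_le_iff₀ hρ).mp (Nat.le_ceil _))
      _ ≤ ⌈h / ρ⌉₊ * ENNReal.ofReal (C * (2 * ρ) ^ (2 * k + 2)) := by
          gcongr
          exact (measure_mono (tube_subset_ball hν ρ)).trans (H _ (by positivity)).2
      _ = ENNReal.ofReal (⌈h / ρ⌉₊ * (C * (2 * ρ) ^ (2 * k + 2))) := by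
          rw [ENNReal.ofReal_mul (Nat.cast_nonneg _), ENNReal.ofReal_natCast]
      _ ≤ ENNReal.ofReal (2 * (h / ρ) * (C * (2 * ρ) ^ (2 * k + 2))) := by gcongr
      _ = _ := by rw [hpow, mul_pow]; congr 1; ring

/-! ### Intrinsic Lipschitz graphs and the measures they carry. -/

lemma IsIntrinsicLipschitzGraphDir.norm_eq_one {lam : ℝ}
    {ν : EuclideanSpace ℝ (Fin k ⊕ Fin k)} {Γ : Set (Heisenberg k)}
    (hΓ : IsIntrinsicLipschitzGraphDir lam ν Γ) : ‖ν‖ = 1 := by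
  simpa using hΓ.2.1

/-- On an intrinsic Lipschitz graph, distances are controlled by the projection to `𝕍_ν`. -/
lemma IsIntrinsicLipschitzGraphDir.dist_le {lam : ℝ} {ν : EuclideanSpace ℝ (Fin k ⊕ Fin k)}
    {Γ : Set (Heisenberg k)} (hΓ : IsIntrinsicLipschitzGraphDir lam ν Γ) {p q : Heisenberg k}
    (hp : p ∈ Γ) (hq : q ∈ Γ) : (1 - lam) * dist q p ≤ koranyi (projV ν (p⁻¹ * q)) := by
  have hcone : p⁻¹ * q ∉ cone lam ν := fun h => by
    have : q ∈ ((fun q => p * q) '' cone lam ν) ∩ Γ := ⟨⟨p⁻¹ * q, h, by simp⟩, hq⟩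
    rw [hΓ.2.2.2 p hp] at this
    exact this
  simp only [cone, Set.mem_ofPred_eq, not_lt] at hcone
  rw [koranyi_projL hΓ.norm_eq_one] at hcone
  have := koranyi_le_projV_add hΓ.norm_eq_one (p⁻¹ * q)
  rw [dist_def]
  linarith

/-- The map sending a point to the point of the graph on the same fibre of `π_{𝕍_ν}` is
continuous. -/
lemma IsIntrinsicLipschitzGraphDir.exists_graphMap {lam : ℝ}
    {ν : EuclideanSpace ℝ (Fin k ⊕ Fin k)} {Γ : Set (Heisenberg k)}
    (hΓ : IsIntrinsicLipschitzGraphDir lam ν Γ) :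
    ∃ γ : Heisenberg k → Heisenberg k, Continuous γ ∧ (∀ q, γ q ∈ Γ) ∧ (∀ q ∈ Γ, γ q = q) ∧
      ∀ p q, projV ν (p * γ q) = projV ν (p * q) := by
  have hν := hΓ.norm_eq_one
  have hlam : 0 < 1 - lam := sub_pos.mpr hΓ.1.2
  have hex : ∀ q, ∃ y ∈ Γ, projV ν y = projV ν q := fun q => by
    have h : projV ν q ∈ projV ν '' Γ := by rw [hΓ.2.2.1]; exact projV_mem hν q
    exact h
  choose γ hγ hproj using hex
  have hproj' : ∀ p q, projV ν (p * γ q) = projV ν (p * q) := fun p q =>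
    projV_mul_left_congr hν (hproj q) p
  have hdist : ∀ p ∈ Γ, ∀ q, dist (γ q) p ≤ koranyi (projV ν (p⁻¹ * q)) / (1 - lam) :=
    fun p hp q => by
      have h := hΓ.dist_le hp (hγ q)
      rw [hproj'] at h
      rwa [le_div_iff₀ hlam, mul_comm]
  refine ⟨γ, continuous_iff_continuousAt.mpr fun q => tendsto_iff_dist_tendsto_zero.mpr ?_, hγ,
    fun q hq => ?_, hproj'⟩
  -- For `x → q` the bound `‖π_𝕍((γ q)⁻¹ x)‖ / (1 - λ)` tends to its value at `q`, which is `0`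
  -- since `q` and `γ q` share a fibre.
  · have hcont : Continuous fun x => koranyi (projV ν ((γ q)⁻¹ * x)) / (1 - lam) :=
      (continuous_koranyi.comp ((continuous_projV ν).comp
        (continuous_mul_left' (γ q)⁻¹))).div_const _
    refine squeeze_zero (fun _ => dist_nonneg) (hdist (γ q) (hγ q)) ?_
    have h := hcont.tendsto q
    rwa [← hproj', inv_mul_cancel, projV_one, koranyi_one, zero_div] at h
  · have h := hdist q hq q
    rw [inv_mul_cancel, projV_one, koranyi_one, zero_div] at h
    exact dist_le_zero.mp h

lemma IsIntrinsicLipschitzGraphDir.isClosed {lam : ℝ} {ν : EuclideanSpace ℝ (Fin k ⊕ Fin k)}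
    {Γ : Set (Heisenberg k)} (hΓ : IsIntrinsicLipschitzGraphDir lam ν Γ) : IsClosed Γ := by
  obtain ⟨γ, hcont, hmem, hfix, -⟩ := hΓ.exists_graphMap
  have : Γ = {q | γ q = q} := Set.ext fun q => ⟨hfix q, fun h => h ▸ hmem q⟩
  rw [this]
  exact isClosed_eq hcont continuous_id

/-- At every scale `h`, an intrinsic Lipschitz graph carries a measure whose balls of radius
`ρ ≤ h / 2` have mass comparable to `h ρ ^ (2 k + 1)`. -/
lemma exists_measure_ball_bounds (k : ℕ) {lam : ℝ} (hlam : lam ∈ Set.Ioo (0 : ℝ) 1) :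
    ∃ c C : ℝ, 0 < c ∧ 0 < C ∧ ∀ (ν : EuclideanSpace ℝ (Fin k ⊕ Fin k)) (Γ : Set (Heisenberg k)),
      IsIntrinsicLipschitzGraphDir lam ν Γ → ∀ h : ℝ, ∃ μ : Measure (Heisenberg k),
        μ Γᶜ = 0 ∧
        (∀ x ∈ Γ, ∀ ρ, 0 < ρ → ρ ≤ h →
          ENNReal.ofReal (c * h * ρ ^ (2 * (k : ℝ) + 1)) ≤ μ (Metric.ball x ρ)) ∧
        ∀ x, ∀ ρ, 0 < ρ → ρ ≤ h / 2 →
          μ (Metric.ball x ρ) ≤ ENNReal.ofReal (C * h * ρ ^ (2 * (k : ℝ) + 1)) := by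
  obtain ⟨c, C, hc, hC, H⟩ := exists_lebesgue_tube_bounds k
  have hl : 0 < 1 - lam := sub_pos.mpr hlam.2
  refine ⟨c * (1 - lam) ^ (2 * k + 1), C * 2 ^ (2 * k + 1), by positivity, by positivity,
    fun ν Γ hΓ h => ?_⟩
  have hν := hΓ.norm_eq_one
  obtain ⟨γ, hcont, hmem, -, hproj⟩ := hΓ.exists_graphMap
  set S := {q : Heisenberg k | inner ℝ q.v ν ∈ Set.Ico (0 : ℝ) (0 + h)}
  have hmap : ∀ {E : Set (Heisenberg k)}, MeasurableSet E →
      (lebesgue.restrict S).map γ E = lebesgue (γ ⁻¹' E ∩ S) := fun hE => by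
    rw [map_apply hcont.measurable hE, restrict_apply (hcont.measurable hE)]
  have hpow : ∀ ρ : ℝ, ρ ^ (2 * (k : ℝ) + 1) = ρ ^ (2 * k + 1) := fun ρ => by
    rw [← Real.rpow_natCast]; push_cast; rfl
  -- The radii `(1 - lam) * ρ` and `2 * ρ` of the inner and outer tubes come from `dist_le` and
  -- `koranyi_projV_le`. The tube bounds need radius at most `h`, whence `ρ ≤ h / 2` in the upper
  -- estimate; there `x` need not lie on `Γ`.
  refine ⟨(lebesgue.restrict S).map γ, ?_, fun x hx ρ hρ hρh => ?_, fun x ρ hρ hρh => ?_⟩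
  · rw [hmap hΓ.isClosed.isOpen_compl.measurableSet]
    have : γ ⁻¹' Γᶜ = ∅ := Set.eq_empty_of_forall_notMem fun q hq => hq (hmem q)
    simp [this]
  · rw [hmap Metric.isOpen_ball.measurableSet, hpow]
    have hle : (1 - lam) * ρ ≤ h := by nlinarith [hlam.1]
    refine le_trans (le_of_eq ?_) ((H ν hν x ((1 - lam) * ρ) 0 h (by positivity) hle).1.trans
      (measure_mono fun q hq => ⟨?_, hq.2⟩))
    · rw [mul_pow]; congr 1; ring
    · have h1 := hΓ.dist_le hx (hmem q)
      rw [hproj] at h1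
      exact lt_of_mul_lt_mul_left (h1.trans_lt hq.1) hl.le
  · rw [hmap Metric.isOpen_ball.measurableSet, hpow]
    refine (measure_mono fun q hq => ?_).trans
      ((H ν hν x (2 * ρ) 0 h (by positivity) (by linarith)).2.trans (le_of_eq ?_))
    · refine ⟨?_, hq.2⟩
      have h1 := koranyi_projV_le hν (x⁻¹ * γ q)
      have h2 : dist (γ q) x < ρ := hq.1
      rw [dist_def] at h2
      rw [hproj] at h1
      linarith
    · rw [mul_pow]; congr 1; ring

end

end Heisenberg

/-! ### Ahlfors regularity. -/

theorem proposition3p7 (k : ℕ) (hk : 1 ≤ k) (lam : ℝ) (hlam : lam ∈ Set.Ioo (0 : ℝ) 1) :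
    ∃ C : ℝ, 1 ≤ C ∧ ∀ Γ : Set (Heisenberg k),
      Heisenberg.IsIntrinsicLipschitzGraph lam Γ →
        Heisenberg.IsAhlforsRegular (2 * (k : ℝ) + 1) C Γ := by
  obtain ⟨c, C, hc, hC, H⟩ := Heisenberg.exists_measure_ball_bounds k hlam
  set s : ℝ := 2 * (k : ℝ) + 1 with hs
  have hs0 : 0 < s := by positivity
  -- The lower bound needs only `C / c`; the upper bound needs `20 ^ s * C / c`, with `10 ^ s` from
  -- the Vitali covering and `2 ^ s` from the doubled ball.
  have hlower : C / c ≤ max 1 (20 ^ s * C / c) := by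
    refine le_max_of_le_right ?_
    rw [mul_div_assoc]
    exact le_mul_of_one_le_left (by positivity) (Real.one_le_rpow (by norm_num) hs0.le)
  refine ⟨max 1 (20 ^ s * C / c), le_max_left _ _, ?_⟩
  rintro Γ ⟨ν, hΓ⟩
  refine ⟨hΓ.isClosed, fun p hp r hr => ?_⟩
  -- The width `4 * r` makes the upper estimate on `μ` valid up to radius `2 * r`, as the doubled
  -- ball requires.
  obtain ⟨μ, hμΓ, hge, hle⟩ := H ν Γ hΓ (4 * r)
  have hcr : 0 < c * (4 * r) := by positivity
  have hCr : 0 < C * (4 * r) := by positivity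
  constructor
  · have h1 := le_smul_hausdorffMeasure_of_ball_le hs0 μ hCr (R := 2 * r) (by positivity)
      (fun x ρ hρ hρr => hle x ρ hρ (by linarith)) (Γ ∩ Metric.ball p r)
    have h2 : μ (Metric.ball p r) ≤ μ (Γ ∩ Metric.ball p r) := by
      rw [Set.inter_comm, measure_inter_conull hμΓ]
    have h3 := (hge p hp r hr (by linarith)).trans (h2.trans h1)
    rw [Measure.smul_apply, smul_eq_mul, ← ENNReal.inv_mul_le_iff (by simpa using hCr)
      ENNReal.ofReal_ne_top, ← ENNReal.ofReal_inv_of_pos hCr,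
      ← ENNReal.ofReal_mul (by positivity)] at h3
    refine le_trans (ENNReal.ofReal_le_ofReal ?_) h3
    calc (max 1 (20 ^ s * C / c))⁻¹ * r ^ s ≤ (C / c)⁻¹ * r ^ s := by
          gcongr
      _ = _ := by field_simp
  · have h1 := hausdorffMeasure_inter_ball_le_of_le_ball hs0 μ hcr hr p
      fun x hx ρ hρ hρr => hge x hx ρ hρ (by linarith)
    have h2 := h1.trans (mul_le_mul_right (hle p (2 * r) (by positivity) (by linarith)) _)
    rw [← ENNReal.ofReal_mul (by positivity), ENNReal.mul_le_iff_le_inv (by simpa using hcr)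
      ENNReal.ofReal_ne_top, ← ENNReal.ofReal_inv_of_pos hcr,
      ← ENNReal.ofReal_mul (by positivity)] at h2
    refine h2.trans (ENNReal.ofReal_le_ofReal ?_)
    calc (c * (4 * r))⁻¹ * (10 ^ s * (C * (4 * r) * (2 * r) ^ s))
        = (10 * 2) ^ s * C / c * r ^ s := by
          rw [Real.mul_rpow (by norm_num) hr.le, Real.mul_rpow (by norm_num) (by norm_num)]
          field_simp
      _ ≤ max 1 (20 ^ s * C / c) * r ^ s := by
          norm_num only
          gcongr
          exact le_max_right _ _
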